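/- Let $\mathbb K$ be a field of characteristic $0$. A framed graph is a finite simple graph $\Gamma$ with a function $f\colon V(\Gamma)\to\mathbb F_2$ (the framing), considered up to framing-preserving isomorphism. Let $G$ be the bialgebra over $\mathbb K$ with basis the framed graphs, whose product is the disjoint union, whose unit is the empty graph, whose counit sends the empty graph to $1$ and all other graphs to $0$, and whose coproduct is $\Delta(\Gamma)=\sum_{V(\Gamma)=p\sqcup q}\Gamma_p\otimes\Gamma_q$, where $\Gamma_p$ is the full framed subgraph on $p$. For adjacent vertices $u,v$ of $\Gamma$ consider the 4-element $$\Gamma-\Gamma'_{uv}-(-1)^{f(v)}\bigl(\tilde\Gamma_{uv}-\tilde\Gamma'_{uv}\bigr),$$ where $\tilde\Gamma_{uv}$ is obtained from $\Gamma$ by toggling the adjacency of $u$ with each neighbour $w\neq u$ of $v$ and replacing the framing of $u$ by $f(u)+f(v)$, and $\Gamma'_{uv}$, $\tilde\Gamma'_{uv}$ are obtained from $\Gamma$, $\tilde\Gamma_{uv}$ by erasing the edge $uv$. The ideal generated by all the 4-elements is a biideal; the quotient bialgebra $\mathcal L$ of $G$ by it is the Lando bialgebra. Let $B\mathcal L$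 and $W\mathcal L$ be the subbialgebras of $\mathcal L$ generated by the classes of the framed graphs with framing identically $0$, respectively identically $1$. For a bialgebra $A$ let $PA=\{p\in A:\Delta(p)=p\otimes 1+1\otimes p\}$, so that $PB\mathcal L=P\mathcal L\cap B\mathcal L$ and $PW\mathcal L=P\mathcal L\cap W\mathcal L$. Theorem. The primitive subspace of $\mathcal L$ admits the direct sum decomposition $$P\mathcal L=PB\mathcal L\oplus PW\mathcal L .$$ Moreover, $PB\mathcal L$ consists exactly of the elements of $P\mathcal L$ that are linear combinations of classes of graphs whose framing is identically $0$, and $PW\mathcal L$ consists exactly of the elements of $P\mathcal L$ that are linear combinations of classes of graphs whose framing is identically $1$. -/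

import Mathlib

open scoped TensorProduct

/-- A framed simple graph with vertex type `V`: a simple graph together with a function
from its vertices to the field with two elements. -/
structure FramedGraph (V : Type) where
  graph : SimpleGraph V
  framing : V → ZMod 2

namespace FramedGraph

/-- Two framed graphs are isomorphic if there is a framing preserving graph isomorphism. -/
def IsIsom {V W : Type} (Γ : FramedGraph V) (Δ : FramedGraph W) : Prop :=
  ∃ e : Γ.graph ≃g Δ.graph, ∀ v, Δ.framing (e v) = Γ.framing v

theorem IsIsom.refl {V : Type} (Γ : FramedGraph V) : IsIsom Γ Γ :=
  ⟨SimpleGraph.Iso.refl, fun _ => rfl⟩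

theorem IsIsom.symm {V W : Type} {Γ : FramedGraph V} {Δ : FramedGraph W}
    (h : IsIsom Γ Δ) : IsIsom Δ Γ := by
  obtain ⟨e, he⟩ := h
  refine ⟨e.symm, fun v => ?_⟩
  have := he (e.symm v)
  rw [← this]
  congr 1
  exact e.apply_symm_apply v

theorem IsIsom.trans {V W X : Type} {Γ : FramedGraph V} {Δ : FramedGraph W}
    {Θ : FramedGraph X} (h : IsIsom Γ Δ) (h' : IsIsom Δ Θ) : IsIsom Γ Θ := by
  obtain ⟨e, he⟩ := h
  obtain ⟨e', he'⟩ := h'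
  exact ⟨e.trans e', fun v => (he' (e v)).trans (he v)⟩

/-- The pullback of a framed graph along a map of vertex types. -/
def comap {V W : Type} (f : W → V) (Γ : FramedGraph V) : FramedGraph W where
  graph := Γ.graph.comap f
  framing := fun w => Γ.framing (f w)

/-- The full framed subgraph on a set of vertices. -/
def induce {V : Type} (Γ : FramedGraph V) (s : Set V) : FramedGraph s :=
  Γ.comap Subtype.val

/-- The disjoint union of framed graphs. -/
def disjUnion {V W : Type} (Γ : FramedGraph V) (Δ : FramedGraph W) : FramedGraph (V ⊕ W) where
  graph := Γ.graph ⊕g Δ.graph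
  framing := Sum.elim Γ.framing Δ.framing

/-- The empty framed graph. -/
def empty : FramedGraph Empty where
  graph := ⊥
  framing := fun v => v.elim

theorem isIsom_comap_equiv {V W : Type} (Γ : FramedGraph V) (e : W ≃ V) :
    IsIsom (Γ.comap e) Γ :=
  ⟨⟨e, Iff.rfl⟩, fun _ => rfl⟩

theorem IsIsom.disjUnion {V W V' W' : Type} {Γ : FramedGraph V} {Δ : FramedGraph W}
    {Γ' : FramedGraph V'} {Δ' : FramedGraph W'} (h : IsIsom Γ Γ') (h' : IsIsom Δ Δ') :
    IsIsom (Γ.disjUnion Δ) (Γ'.disjUnion Δ') := by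
  obtain ⟨e, he⟩ := h
  obtain ⟨e', he'⟩ := h'
  refine ⟨⟨Equiv.sumCongr e.toEquiv e'.toEquiv, ?_⟩, ?_⟩
  · rintro (a | a) (b | b)
    · simpa [FramedGraph.disjUnion] using e.map_adj_iff
    · simp [FramedGraph.disjUnion]
    · simp [FramedGraph.disjUnion]
    · simpa [FramedGraph.disjUnion] using e'.map_adj_iff
  · rintro (a | a)
    · exact he a
    · exact he' a

/-- Framed graphs on the standard finite vertex sets, up to isomorphism. -/
def isomSetoid : Setoid (Σ n : ℕ, FramedGraph (Fin n)) where
  r a b := IsIsom a.2 b.2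
  iseqv := ⟨fun a => IsIsom.refl a.2, fun h => h.symm, fun h h' => h.trans h'⟩

end FramedGraph

/-- Isomorphism classes of finite framed simple graphs. -/
def FramedGraphClass : Type := Quotient FramedGraph.isomSetoid

namespace FramedGraphClass

open FramedGraph

/-- The isomorphism class of a framed graph on an arbitrary finite vertex type. -/
noncomputable def mk {V : Type} [Finite V] (Γ : FramedGraph V) : FramedGraphClass :=
  Quotient.mk isomSetoid ⟨Nat.card V, Γ.comap (Finite.equivFin V).symm⟩

theorem mk_eq_mk {V W : Type} [Finite V] [Finite W] (Γ : FramedGraph V) (Δ : FramedGraph W) :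
    mk Γ = mk Δ ↔ IsIsom Γ Δ := by
  have h1 := isIsom_comap_equiv Γ (Finite.equivFin V).symm
  have h2 := isIsom_comap_equiv Δ (Finite.equivFin W).symm
  constructor
  · intro h
    exact h1.symm.trans ((Quotient.exact h : IsIsom _ _).trans h2)
  · intro h
    exact Quotient.sound (s := isomSetoid)
      (show IsIsom _ _ from h1.trans (h.trans h2.symm))

theorem quotient_mk_eq (a : Σ n : ℕ, FramedGraph (Fin n)) :
    Quotient.mk isomSetoid a = mk a.2 :=
  Quotient.sound (s := isomSetoid) (show IsIsom _ _ from
    (isIsom_comap_equiv a.2 (Finite.equivFin (Fin a.1)).symm).symm)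

theorem ind {p : FramedGraphClass → Prop}
    (h : ∀ (n : ℕ) (Γ : FramedGraph (Fin n)), p (mk Γ)) (x : FramedGraphClass) : p x := by
  induction x using Quotient.ind with
  | _ a => rw [quotient_mk_eq]; exact h a.1 a.2

theorem mk_comap_eq_induce {V W : Type} [Finite V] [Finite W] (Γ : FramedGraph V) (f : W → V)
    (hf : Function.Injective f) (s : Set V) (hs : Set.range f = s) :
    mk (Γ.comap f) = mk (Γ.induce s) := by
  subst hs
  rw [mk_eq_mk]
  exact ⟨⟨Equiv.ofInjective f hf, Iff.rfl⟩, fun _ => rfl⟩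

/-- The product of isomorphism classes is the disjoint union. -/
noncomputable def mul (x y : FramedGraphClass) : FramedGraphClass :=
  Quotient.liftOn₂ (s₁ := isomSetoid) (s₂ := isomSetoid) x y
    (fun a b => mk (a.2.disjUnion b.2))
    (fun _ _ _ _ h h' => (mk_eq_mk _ _).2 (IsIsom.disjUnion h h'))

theorem mul_mk {V W : Type} [Finite V] [Finite W] (Γ : FramedGraph V) (Δ : FramedGraph W) :
    mul (mk Γ) (mk Δ) = mk (Γ.disjUnion Δ) :=
  (mk_eq_mk _ _).2 (IsIsom.disjUnion (isIsom_comap_equiv _ _) (isIsom_comap_equiv _ _))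

theorem mul_comm' (x y : FramedGraphClass) : mul x y = mul y x := by
  induction x using ind with | _ n Γ
  induction y using ind with | _ m Δ
  rw [mul_mk, mul_mk, mk_eq_mk]
  refine ⟨⟨Equiv.sumComm _ _, ?_⟩, ?_⟩
  · rintro (a | a) (b | b) <;> simp [FramedGraph.disjUnion]
  · rintro (a | a) <;> rfl

theorem mul_assoc' (x y z : FramedGraphClass) : mul (mul x y) z = mul x (mul y z) := by
  induction x using ind with | _ n Γ
  induction y using ind with | _ m Δ
  induction z using ind with | _ k Θ
  simp only [mul_mk]
  rw [mk_eq_mk]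
  refine ⟨⟨Equiv.sumAssoc _ _ _, ?_⟩, ?_⟩
  · rintro ((a | a) | a) ((b | b) | b) <;> simp [FramedGraph.disjUnion]
  · rintro ((a | a) | a) <;> rfl

theorem one_mul' (x : FramedGraphClass) : mul (mk FramedGraph.empty) x = x := by
  induction x using ind with | _ n Γ
  rw [mul_mk, mk_eq_mk]
  refine ⟨⟨Equiv.emptySum _ _, ?_⟩, ?_⟩
  · rintro (a | a) (b | b)
    · exact a.elim
    · exact a.elim
    · exact b.elim
    · simp [FramedGraph.disjUnion]
  · rintro (a | a)
    · exact a.elim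
    · rfl

/-- Isomorphism classes of framed graphs form a commutative monoid under disjoint union, whose
unit is the empty graph. -/
noncomputable instance : CommMonoid FramedGraphClass where
  mul := mul
  one := mk FramedGraph.empty
  mul_assoc := mul_assoc'
  one_mul := one_mul'
  mul_one x := (mul_comm' _ _).trans (one_mul' x)
  mul_comm := mul_comm'

theorem one_def : (1 : FramedGraphClass) = mk FramedGraph.empty := rfl

theorem mk_mul_mk {V W : Type} [Finite V] [Finite W] (Γ : FramedGraph V) (Δ : FramedGraph W) :
    mk Γ * mk Δ = mk (Γ.disjUnion Δ) :=
  mul_mk Γ Δ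

theorem mk_eq_one_iff {V : Type} [Finite V] (Γ : FramedGraph V) : mk Γ = 1 ↔ IsEmpty V := by
  rw [one_def, mk_eq_mk]
  constructor
  · rintro ⟨e, -⟩
    exact e.toEquiv.isEmpty
  · intro h
    exact ⟨⟨Equiv.equivOfIsEmpty V Empty, fun {a} => isEmptyElim a⟩, fun a => isEmptyElim a⟩

theorem mul_eq_one_iff' (x y : FramedGraphClass) : x * y = 1 ↔ x = 1 ∧ y = 1 := by
  induction x using ind with | _ n Γ
  induction y using ind with | _ m Δ
  rw [mk_mul_mk, mk_eq_one_iff, mk_eq_one_iff, mk_eq_one_iff, isEmpty_sum]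

end FramedGraphClass

/-- The underlying space of the Joni-Rota bialgebra: the vector space spanned by the isomorphism
classes of finite framed graphs. It is a type synonym because its coproduct is not the group-like
one of a monoid algebra. -/
def GraphBialgebra (K : Type*) [Field K] : Type _ := MonoidAlgebra K FramedGraphClass

namespace GraphBialgebra

open FramedGraph FramedGraphClass

variable (K : Type*) [Field K]

noncomputable instance : CommRing (GraphBialgebra K) :=
  inferInstanceAs (CommRing (MonoidAlgebra K FramedGraphClass))

noncomputable instance : Algebra K (GraphBialgebra K) :=
  inferInstanceAs (Algebra K (MonoidAlgebra K FramedGraphClass))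

/-- The basis element of an isomorphism class; the product is the disjoint union. -/
noncomputable def of : FramedGraphClass →* GraphBialgebra K :=
  MonoidAlgebra.of K FramedGraphClass

/-- The basis element of a framed graph. -/
noncomputable def gen {V : Type} [Finite V] (Γ : FramedGraph V) : GraphBialgebra K :=
  of K (mk Γ)

/-- Multiplicative extension by linearity of a function on graphs. -/
noncomputable def lift {A : Type*} [Semiring A] [Algebra K A] (F : FramedGraphClass →* A) :
    GraphBialgebra K →ₐ[K] A :=
  MonoidAlgebra.lift K A FramedGraphClass F

theorem lift_of {A : Type*} [Semiring A] [Algebra K A] (F : FramedGraphClass →* A)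
    (x : FramedGraphClass) : lift K F (of K x) = F x :=
  MonoidAlgebra.lift_of F x

variable {K} in
theorem algHom_ext {A : Type*} [Semiring A] [Algebra K A] {φ ψ : GraphBialgebra K →ₐ[K] A}
    (h : ∀ (n : ℕ) (Γ : FramedGraph (Fin n)), φ (gen K Γ) = ψ (gen K Γ)) : φ = ψ := by
  apply (MonoidAlgebra.lift K A FramedGraphClass).symm.injective
  ext x
  induction x using ind with | _ n Γ
  exact h n Γ

theorem gen_induce_congr {V : Type} [Finite V] (Γ : FramedGraph V) {s t : Set V} (h : s = t) :
    gen K (Γ.induce s) = gen K (Γ.induce t) := by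
  subst h
  rfl

/-- The value of the coproduct on a framed graph `Γ`: the sum over all the ways to split the set
of vertices into a set `s` and its complement. -/
noncomputable def splitSum {V : Type} [Fintype V] (Γ : FramedGraph V) :
    GraphBialgebra K ⊗[K] GraphBialgebra K :=
  ∑ s : Set V, gen K (Γ.induce s) ⊗ₜ[K] gen K (Γ.induce sᶜ)

theorem splitSum_congr {V W : Type} [Fintype V] [Fintype W] {Γ : FramedGraph V}
    {Δ : FramedGraph W} (h : IsIsom Γ Δ) : splitSum K Γ = splitSum K Δ := by
  obtain ⟨e, he⟩ := h
  have key : ∀ s : Set V, gen K (Γ.induce s) = gen K (Δ.induce (e '' s)) := by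
    intro s
    unfold gen
    congr 1
    rw [← mk_comap_eq_induce Δ (fun x : s => e x)
      (e.injective.comp Subtype.val_injective) (e '' s) (by ext; simp)]
    rw [mk_eq_mk]
    exact ⟨⟨Equiv.refl _, fun {a b} => e.map_adj_iff⟩, fun v => he v⟩
  refine Fintype.sum_equiv (Equiv.Set.congr e.toEquiv) _ _ fun s => ?_
  rw [key, key, gen_induce_congr K Δ (Set.image_compl_eq e.bijective)]
  rfl

/-- The coproduct on isomorphism classes. -/
noncomputable def comulClass (x : FramedGraphClass) : GraphBialgebra K ⊗[K] GraphBialgebra K :=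
  Quotient.liftOn (s := isomSetoid) x (fun a => splitSum K a.2)
    (fun _ _ h => splitSum_congr K h)

theorem comulClass_mk {V : Type} [Fintype V] (Γ : FramedGraph V) :
    comulClass K (mk Γ) = splitSum K Γ :=
  splitSum_congr K (isIsom_comap_equiv _ _)

theorem induce_disjUnion {V W : Type} [Finite V] [Finite W] (Γ : FramedGraph V)
    (Δ : FramedGraph W) (s : Set (V ⊕ W)) :
    gen K ((Γ.disjUnion Δ).induce s) =
      gen K (Γ.induce (Sum.inl ⁻¹' s)) * gen K (Δ.induce (Sum.inr ⁻¹' s)) := by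
  unfold gen
  rw [← map_mul, mk_mul_mk]
  congr 1
  rw [← mk_comap_eq_induce (Γ.disjUnion Δ)
    (Sum.map (Subtype.val : ↥(Sum.inl ⁻¹' s) → V) (Subtype.val : ↥(Sum.inr ⁻¹' s) → W))
    (Subtype.val_injective.sumMap Subtype.val_injective) s ?_]
  · rw [mk_eq_mk]
    refine ⟨⟨Equiv.refl _, ?_⟩, ?_⟩
    · rintro (a | a) (b | b) <;>
        simp [FramedGraph.disjUnion, FramedGraph.comap, FramedGraph.induce]
    · rintro (a | a) <;> rfl
  · ext (x | x) <;> simp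

theorem splitSum_disjUnion {V W : Type} [Fintype V] [Fintype W] (Γ : FramedGraph V)
    (Δ : FramedGraph W) :
    splitSum K (Γ.disjUnion Δ) = splitSum K Γ * splitSum K Δ := by
  unfold splitSum
  rw [Fintype.sum_mul_sum, ← Fintype.sum_prod_type']
  refine Fintype.sum_bijective
    (fun s : Set (V ⊕ W) => ((Sum.inl ⁻¹' s, Sum.inr ⁻¹' s) : Set V × Set W)) ?_ _ _ ?_
  · constructor
    · intro s t h
      simp only [Prod.mk.injEq] at h
      ext (x | x)
      · exact Set.ext_iff.1 h.1 x
      · exact Set.ext_iff.1 h.2 x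
    · rintro ⟨a, b⟩
      refine ⟨Sum.inl '' a ∪ Sum.inr '' b, ?_⟩
      ext x <;> simp
  · intro s
    rw [Algebra.TensorProduct.tmul_mul_tmul, induce_disjUnion, induce_disjUnion]
    rfl

theorem splitSum_empty : splitSum K FramedGraph.empty = 1 := by
  have h : ∀ s : Set Empty, gen K (FramedGraph.empty.induce s) = 1 := by
    intro s
    have : IsEmpty s := ⟨fun x => x.1.elim⟩
    unfold gen
    rw [(mk_eq_one_iff _).2 this, map_one]
  unfold splitSum
  simp only [h]
  rw [Fintype.sum_unique]
  rfl

/-- The coproduct as an algebra homomorphism. -/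
noncomputable def comulHom : GraphBialgebra K →ₐ[K] GraphBialgebra K ⊗[K] GraphBialgebra K :=
  lift K
    { toFun := comulClass K
      map_one' := by rw [one_def, comulClass_mk, splitSum_empty]
      map_mul' := by
        intro x y
        induction x using ind with | _ n Γ
        induction y using ind with | _ m Δ
        rw [mk_mul_mk, comulClass_mk, comulClass_mk, comulClass_mk, splitSum_disjUnion] }

theorem comulHom_gen {V : Type} [Fintype V] (Γ : FramedGraph V) :
    comulHom K (gen K Γ) = ∑ s : Set V, gen K (Γ.induce s) ⊗ₜ[K] gen K (Γ.induce sᶜ) :=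
  (lift_of K _ _).trans (comulClass_mk K Γ)

open Classical in
/-- The counit: the empty graph goes to `1` and all the other graphs to `0`. -/
noncomputable def counitHom : GraphBialgebra K →ₐ[K] K :=
  lift K
    { toFun := fun x => if x = 1 then 1 else 0
      map_one' := if_pos rfl
      map_mul' := by
        intro x y
        by_cases hx : x = 1 <;> by_cases hy : y = 1 <;> simp [mul_eq_one_iff', hx, hy] }

open Classical in
theorem counitHom_gen {V : Type} [Finite V] (Γ : FramedGraph V) :
    counitHom K (gen K Γ) = if IsEmpty V then 1 else 0 := by
  refine (lift_of K _ _).trans ?_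
  simp [mk_eq_one_iff]

theorem gen_induce_induce {V : Type} [Finite V] (Γ : FramedGraph V) (s : Set V) (t : Set s) :
    gen K ((Γ.induce s).induce t) = gen K (Γ.induce (Subtype.val '' t)) := by
  unfold gen
  congr 1
  exact mk_comap_eq_induce Γ (fun x : t => ((x : s) : V))
    (Subtype.val_injective.comp Subtype.val_injective) _ (by ext; simp)

open Classical in
theorem comulHom_gen_induce {V : Type} [Fintype V] (Γ : FramedGraph V) (s : Set V) :
    comulHom K (gen K (Γ.induce s)) =
      ∑ t : Set V with t ⊆ s, gen K (Γ.induce t) ⊗ₜ[K] gen K (Γ.induce (s \ t)) := by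
  rw [comulHom_gen]
  refine Finset.sum_bij' (fun t _ => Subtype.val '' t) (fun t _ => Subtype.val ⁻¹' t)
    ?_ ?_ ?_ ?_ ?_
  · intro t _
    simp
  · intro t _
    simp
  · intro t _
    exact Set.preimage_image_eq _ Subtype.val_injective
  · intro t ht
    simpa using ht
  · intro t _
    rw [gen_induce_induce, gen_induce_induce]
    refine congrArg _ (gen_induce_congr K Γ ?_)
    ext x
    by_cases hx : x ∈ s <;> simp [hx]

theorem gen_induce_univ {V : Type} [Finite V] (Γ : FramedGraph V) :
    gen K (Γ.induce Set.univ) = gen K Γ := by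
  unfold gen
  congr 1
  exact (mk_comap_eq_induce Γ id Function.injective_id Set.univ Set.range_id).symm

theorem gen_of_isEmpty {V : Type} [Finite V] [h : IsEmpty V] (Γ : FramedGraph V) :
    gen K Γ = 1 := by
  unfold gen
  rw [(mk_eq_one_iff _).2 h, map_one]

/-- The Joni-Rota bialgebra of framed graphs. -/
noncomputable instance : Bialgebra K (GraphBialgebra K) :=
  Bialgebra.ofAlgHom (comulHom K) (counitHom K)
    (by
      classical
      apply algHom_ext
      intro n Γ
      simp only [AlgHom.comp_apply]
      rw [comulHom_gen]
      simp only [map_sum, Algebra.TensorProduct.map_tmul,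
        comulHom_gen_induce, TensorProduct.sum_tmul, TensorProduct.tmul_sum, AlgHom.id_apply]
      rw [Finset.sum_sigma', Finset.sum_sigma']
      refine Finset.sum_bij' (fun p _ => ⟨p.2, p.1 \ p.2⟩) (fun p _ => ⟨p.1 ∪ p.2, p.1⟩)
        ?_ ?_ ?_ ?_ ?_
      · rintro ⟨s, t⟩ h
        simp only [Finset.mem_sigma, Finset.mem_univ, Finset.mem_filter, true_and] at h ⊢
        exact fun x hx => hx.2
      · rintro ⟨s, t⟩ h
        simp
      · rintro ⟨s, t⟩ h
        simp only [Finset.mem_sigma, Finset.mem_univ, Finset.mem_filter, true_and] at h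
        simp [Set.union_eq_right.2 h]
      · rintro ⟨s, t⟩ h
        simp only [Finset.mem_sigma, Finset.mem_univ, Finset.mem_filter, true_and] at h
        have : (s ∪ t) \ s = t := by
          ext x
          have := @h x
          simp only [Set.mem_sdiff, Set.mem_union, Set.mem_compl_iff] at this ⊢
          tauto
        simp [this]
      · rintro ⟨s, t⟩ h
        simp only [Finset.mem_sigma, Finset.mem_univ, Finset.mem_filter, true_and] at h
        have : tᶜ \ (s \ t) = sᶜ := by
          ext x
          have := @h x
          simp only [Set.mem_sdiff, Set.mem_compl_iff] at this ⊢
          tauto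
        simp only
        rw [gen_induce_congr K Γ this]
        rfl)
    (by
      apply algHom_ext
      intro n Γ
      simp only [AlgHom.comp_apply, comulHom_gen, map_sum, Algebra.TensorProduct.map_tmul,
        AlgHom.id_apply, counitHom_gen]
      rw [Finset.sum_eq_single ∅]
      · have : IsEmpty (∅ : Set (Fin n)) := inferInstance
        rw [gen_induce_congr K Γ Set.compl_empty, gen_induce_univ, if_pos this]
        rfl
      · intro s _ hs
        have : ¬ IsEmpty s := by
          rwa [Set.isEmpty_coe_sort]
        simp [this]
      · simp)
    (by
      apply algHom_ext
      intro n Γ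
      simp only [AlgHom.comp_apply, comulHom_gen, map_sum, Algebra.TensorProduct.map_tmul,
        AlgHom.id_apply, counitHom_gen]
      rw [Finset.sum_eq_single Set.univ]
      · simp [gen_induce_univ]
      · intro s _ hs
        have : ¬ IsEmpty (sᶜ : Set (Fin n)) := by
          rwa [Set.isEmpty_coe_sort, Set.compl_empty_iff]
        simp [this]
      · simp)

theorem comul_gen {V : Type} [Fintype V] (Γ : FramedGraph V) :
    Coalgebra.comul (R := K) (gen K Γ) =
      ∑ s : Set V, gen K (Γ.induce s) ⊗ₜ[K] gen K (Γ.induce sᶜ) :=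
  comulHom_gen K Γ

open Classical in
theorem counit_gen {V : Type} [Finite V] (Γ : FramedGraph V) :
    Coalgebra.counit (R := K) (gen K Γ) = if IsEmpty V then (1 : K) else 0 :=
  counitHom_gen K Γ

end GraphBialgebra

namespace FramedGraph

/-- The framed graph `Γ'` obtained by erasing the edge between `u` and `v`. -/
def eraseEdge {V : Type} (Γ : FramedGraph V) (u v : V) : FramedGraph V where
  graph := Γ.graph.deleteEdges {s(u, v)}
  framing := Γ.framing

open Classical in
/-- The framed graph obtained by toggling the adjacency of `u` with every neighbour `w` of `v`
different from `u` and `v`, and by replacing the framing of `u` with `f u + f v`. -/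
noncomputable def slide {V : Type} (Γ : FramedGraph V) (u v : V) : FramedGraph V where
  graph :=
    { Adj := fun a b => a ≠ b ∧
        Xor (Γ.graph.Adj a b)
          ((a = u ∧ b ≠ v ∧ Γ.graph.Adj v b) ∨ (b = u ∧ a ≠ v ∧ Γ.graph.Adj v a))
      symm := ⟨fun a b h => ⟨h.1.symm, by
        rw [Γ.graph.adj_comm b a, or_comm]
        exact h.2⟩⟩
      loopless := ⟨fun _ h => h.1 rfl⟩ }
  framing := fun w => if w = u then Γ.framing u + Γ.framing v else Γ.framing w

theorem eraseEdge_induce {V : Type} (Γ : FramedGraph V) (u v : V) (s : Set V)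
    (h : ¬ (u ∈ s ∧ v ∈ s)) : (Γ.eraseEdge u v).induce s = Γ.induce s := by
  unfold induce comap eraseEdge
  congr 1
  ext ⟨a, ha⟩ ⟨b, hb⟩
  simp only [SimpleGraph.comap_adj, SimpleGraph.deleteEdges_adj, Set.mem_singleton_iff,
    Sym2.eq_iff, and_iff_left_iff_imp]
  rintro - (⟨rfl, rfl⟩ | ⟨rfl, rfl⟩)
  · exact h ⟨ha, hb⟩
  · exact h ⟨hb, ha⟩

theorem eraseEdge_induce_mem {V : Type} (Γ : FramedGraph V) (u v : V) (s : Set V)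
    (hu : u ∈ s) (hv : v ∈ s) :
    (Γ.eraseEdge u v).induce s = (Γ.induce s).eraseEdge ⟨u, hu⟩ ⟨v, hv⟩ := by
  unfold induce comap eraseEdge
  congr 1
  ext ⟨a, ha⟩ ⟨b, hb⟩
  simp

theorem slide_induce {V : Type} (Γ : FramedGraph V) (u v : V) (s : Set V)
    (h : u ∉ s) : (Γ.slide u v).induce s = Γ.induce s := by
  have hne : ∀ a ∈ s, a ≠ u := fun a ha hau => h (hau ▸ ha)
  unfold induce comap slide
  congr 1
  · ext ⟨a, ha⟩ ⟨b, hb⟩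
    simp only [SimpleGraph.comap_adj, hne a ha, hne b hb, false_and, or_self, xor_def, not_false_eq_true,
      and_true, or_false]
    exact ⟨fun h => h.2, fun h => ⟨h.ne, h⟩⟩
  · funext ⟨a, ha⟩
    simp [hne a ha]

theorem slide_induce_mem {V : Type} (Γ : FramedGraph V) (u v : V) (s : Set V)
    (hu : u ∈ s) (hv : v ∈ s) :
    (Γ.slide u v).induce s = (Γ.induce s).slide ⟨u, hu⟩ ⟨v, hv⟩ := by
  unfold induce comap slide
  congr 1
  · ext ⟨a, ha⟩ ⟨b, hb⟩
    simp
  · funext ⟨a, ha⟩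
    by_cases h : a = u
    · subst h
      simp
    · have h' : (⟨a, ha⟩ : s) ≠ ⟨u, hu⟩ := fun h' => h (congrArg Subtype.val h')
      simp [h, h']

end FramedGraph

namespace GraphBialgebra

open FramedGraph FramedGraphClass

variable (K : Type*) [Field K]

/-- The 4-element of a framed graph `Γ` and an ordered pair `u`, `v` of its vertices. -/
noncomputable def fourElement {V : Type} [Finite V] (Γ : FramedGraph V) (u v : V) :
    GraphBialgebra K :=
  gen K Γ - gen K (Γ.eraseEdge u v) -
    ((-1 : K) ^ (Γ.framing v).val) • (gen K (Γ.slide u v) - gen K ((Γ.slide u v).eraseEdge u v))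

/-- The ideal generated by the 4-elements of all the finite framed graphs and all the ordered
pairs of adjacent vertices. -/
noncomputable def fourIdeal : Ideal (GraphBialgebra K) :=
  Ideal.span {x | ∃ (V : Type) (_ : Finite V) (Γ : FramedGraph V) (u v : V),
    Γ.graph.Adj u v ∧ x = fourElement K Γ u v}

theorem fourElement_mem {V : Type} [Finite V] (Γ : FramedGraph V) (u v : V)
    (h : Γ.graph.Adj u v) : fourElement K Γ u v ∈ fourIdeal K :=
  Ideal.subset_span ⟨V, inferInstance, Γ, u, v, h, rfl⟩

/-- The ideal generated by the 4-elements is a biideal. -/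
instance : ((fourIdeal K).restrictScalars K).IsCoideal where
  counit_eq_zero := by
    have : fourIdeal K ≤ RingHom.ker (Bialgebra.counitAlgHom K (GraphBialgebra K)) := by
      refine Ideal.span_le.2 ?_
      rintro _ ⟨V, _, Γ, u, v, -, rfl⟩
      have hV : ¬ IsEmpty V := fun h => h.elim u
      simp [fourElement, counit_gen, hV]
    exact this
  map_mkQ_comul_eq_zero := by
    have : fourIdeal K ≤ RingHom.ker
        ((Algebra.TensorProduct.map (Ideal.Quotient.mkₐ K (fourIdeal K))
          (Ideal.Quotient.mkₐ K (fourIdeal K))).comp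
          (Bialgebra.comulAlgHom K (GraphBialgebra K))) := by
      refine Ideal.span_le.2 ?_
      rintro _ ⟨V, _, Γ, u, v, huv, rfl⟩
      have := Fintype.ofFinite V
      set q := Ideal.Quotient.mkₐ K (fourIdeal K) with hq
      have hzero : ∀ s : Set V, u ∈ s → v ∈ s →
          q (gen K (Γ.induce s)) - q (gen K ((Γ.eraseEdge u v).induce s)) -
          ((-1 : K) ^ (Γ.framing v).val) • (q (gen K ((Γ.slide u v).induce s)) -
            q (gen K (((Γ.slide u v).eraseEdge u v).induce s))) = 0 := by
        intro s hu hv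
        have hmem := fourElement_mem K (Γ.induce s) ⟨u, hu⟩ ⟨v, hv⟩ huv
        have h0 : q (fourElement K (Γ.induce s) ⟨u, hu⟩ ⟨v, hv⟩) = 0 :=
          Ideal.Quotient.eq_zero_iff_mem.2 hmem
        rw [eraseEdge_induce_mem _ _ _ _ hu hv, eraseEdge_induce_mem _ _ _ _ hu hv,
          slide_induce_mem _ _ _ _ hu hv, ← h0]
        simp only [fourElement, map_sub, map_smul]
        rfl
      have hcomul : ∀ Δ : FramedGraph V, ((Algebra.TensorProduct.map q q).comp
          (Bialgebra.comulAlgHom K (GraphBialgebra K))) (gen K Δ) =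
          ∑ s : Set V, q (gen K (Δ.induce s)) ⊗ₜ[K] q (gen K (Δ.induce sᶜ)) := by
        intro Δ
        simp [comul_gen]
      simp only [SetLike.mem_coe, RingHom.mem_ker]
      show ((Algebra.TensorProduct.map q q).comp
          (Bialgebra.comulAlgHom K (GraphBialgebra K))) (fourElement K Γ u v) = 0
      unfold fourElement
      rw [map_sub, map_sub, map_smul, map_sub]
      simp only [hcomul, Finset.smul_sum, ← Finset.sum_sub_distrib]
      refine Finset.sum_eq_zero fun s _ => ?_
      by_cases hu : u ∈ s <;> by_cases hv : v ∈ s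
      · have hu' : u ∉ sᶜ := fun h => h hu
        rw [eraseEdge_induce _ _ _ sᶜ (fun h => hu' h.1),
          eraseEdge_induce _ _ _ sᶜ (fun h => hu' h.1), slide_induce _ _ _ sᶜ hu',
          ← TensorProduct.sub_tmul, ← TensorProduct.sub_tmul, TensorProduct.smul_tmul',
          ← TensorProduct.sub_tmul, hzero s hu hv, TensorProduct.zero_tmul]
      · have hv' : ¬ (u ∈ s ∧ v ∈ s) := fun h => hv h.2
        have hu' : ¬ (u ∈ sᶜ ∧ v ∈ sᶜ) := fun h => h.1 hu
        simp only [eraseEdge_induce _ _ _ _ hv', eraseEdge_induce _ _ _ _ hu', sub_self, smul_zero]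
      · have hv' : ¬ (u ∈ s ∧ v ∈ s) := fun h => hu h.1
        have hu' : ¬ (u ∈ sᶜ ∧ v ∈ sᶜ) := fun h => h.2 hv
        simp only [eraseEdge_induce _ _ _ _ hv', eraseEdge_induce _ _ _ _ hu', sub_self, smul_zero]
      · rw [eraseEdge_induce _ _ _ s (fun h => hu h.1),
          eraseEdge_induce _ _ _ s (fun h => hu h.1), slide_induce _ _ _ s hu,
          ← TensorProduct.tmul_sub, ← TensorProduct.tmul_sub, ← TensorProduct.tmul_smul,
          ← TensorProduct.tmul_sub, hzero sᶜ hu hv, TensorProduct.tmul_zero]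
    exact this

end GraphBialgebra

/-- The Lando framed graph bialgebra: the quotient bialgebra of the Joni-Rota bialgebra of framed
graphs by the biideal generated by the 4-elements. -/
abbrev LandoBialgebra (K : Type*) [Field K] : Type _ :=
  GraphBialgebra K ⧸ GraphBialgebra.fourIdeal K

/-- The primitive subspace of a bialgebra. -/
def primitiveSubspace (K A : Type*) [CommRing K] [Ring A] [Bialgebra K A] : Submodule K A where
  carrier := {p | Coalgebra.comul (R := K) p = p ⊗ₜ[K] 1 + 1 ⊗ₜ[K] p}
  add_mem' := by
    intro a b ha hb
    simp only [Set.mem_ofPred_eq] at *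
    rw [map_add, ha, hb, TensorProduct.add_tmul, TensorProduct.tmul_add]
    abel
  zero_mem' := by simp
  smul_mem' := by
    intro c a ha
    simp only [Set.mem_ofPred_eq] at *
    rw [map_smul, ha, smul_add, TensorProduct.smul_tmul', TensorProduct.tmul_smul]

namespace LandoBialgebra

open FramedGraph

variable (K : Type*) [Field K]

/-- The class of a framed graph in the Lando bialgebra. -/
noncomputable def cls {V : Type} [Finite V] (Γ : FramedGraph V) : LandoBialgebra K :=
  Ideal.Quotient.mk (GraphBialgebra.fourIdeal K) (GraphBialgebra.gen K Γ)

theorem comul_cls {V : Type} [Fintype V] (Γ : FramedGraph V) :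
    Coalgebra.comul (R := K) (cls K Γ) =
      ∑ s : Set V, cls K (Γ.induce s) ⊗ₜ[K] cls K (Γ.induce sᶜ) := by
  unfold cls
  rw [Bialgebra.Quotient.comul_mk, GraphBialgebra.comul_gen, map_sum]
  rfl

/-- The classes of the finite framed graphs whose framing is identically equal to `c`. -/
def constFramed (c : ZMod 2) : Set (LandoBialgebra K) :=
  {x | ∃ (V : Type) (_ : Finite V) (Γ : FramedGraph V), (∀ v, Γ.framing v = c) ∧ x = cls K Γ}

/-- The subbialgebra generated by the graphs whose framing is identically equal to `c`. -/
noncomputable def constSubbialgebra (c : ZMod 2) : Subalgebra K (LandoBialgebra K) :=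
  Algebra.adjoin K (constFramed K c)

/-- The subalgebra generated by the graphs of constant framing `c` is closed under the coproduct,
so that it is a subbialgebra. -/
theorem comul_mem_constSubbialgebra (c : ZMod 2) (x : LandoBialgebra K)
    (hx : x ∈ constSubbialgebra K c) :
    Coalgebra.comul (R := K) x ∈ (Algebra.TensorProduct.map (constSubbialgebra K c).val
      (constSubbialgebra K c).val).range := by
  have h : constSubbialgebra K c ≤ ((Algebra.TensorProduct.map (constSubbialgebra K c).val
      (constSubbialgebra K c).val).range).comap
        (Bialgebra.comulAlgHom K (LandoBialgebra K)) := by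
    refine Algebra.adjoin_le ?_
    rintro _ ⟨V, _, Γ, hΓ, rfl⟩
    have := Fintype.ofFinite V
    rw [SetLike.mem_coe, Subalgebra.mem_comap, Bialgebra.comulAlgHom_apply]
    rw [comul_cls]
    refine Subalgebra.sum_mem _ fun s _ => ?_
    exact ⟨⟨cls K (Γ.induce s), Algebra.subset_adjoin ⟨s, inferInstance, _, fun v => hΓ v, rfl⟩⟩
      ⊗ₜ[K] ⟨cls K (Γ.induce sᶜ), Algebra.subset_adjoin
        ⟨(sᶜ : Set V), inferInstance, _, fun v => hΓ v, rfl⟩⟩, rfl⟩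
  exact h hx

/-- The primitive subspace of the subbialgebra generated by the graphs of constant framing `c`,
as a subspace of the Lando bialgebra. -/
noncomputable def constPrimitive (c : ZMod 2) : Submodule K (LandoBialgebra K) :=
  primitiveSubspace K (LandoBialgebra K) ⊓ Subalgebra.toSubmodule (constSubbialgebra K c)

end LandoBialgebra

/-! Write $B=B\mathcal L$ and $W=W\mathcal L$. Sending a graph to itself if its framing is $0$ and
to $0$ otherwise respects the 4-elements, and gives a bialgebra projection `proj` of $\mathcal L$
onto $B$. For a primitive $p$, both `proj p` $\in B$ and $r=p-$ `proj p` are primitive, so the point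
is that a primitive $r$ killed by `proj` lies in $W$.

Two facts give this. Applying 4-elements with $f(u)=0$, $f(v)=1$ trades edges between the two
framings for vertices of framing $1$, so $\mathcal L=B\cdot W$ (`cls_mem_spanProducts`). On the
other hand $\mathcal L$ coacts on the right by $(\mathrm{id}\otimes\mathrm{proj})\Delta$, and, as
for any Hopf algebra with a projection, $x\mapsto x_{(1)}S(\mathrm{proj}\,x_{(2)})$ maps onto the
coinvariants. It sends $bw$ to $\varepsilon(b)w$, hence everything into $W$, and it fixes $r$, since
$r$ is coinvariant (`mem_span_of_primitive_of_proj_eq_zero`). The antipode $S$ is replaced by a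
truncated geometric series, exact on small enough graphs.

The sum is direct because `proj` is the identity on $B$ and the counit on $W$, and the counit
vanishes on primitives. -/

/-! ### Graphs of constant framing -/

namespace FramedGraphClass

open FramedGraph

/-- The isomorphism classes of the framed graphs whose framing is identically `c`. -/
def IsConst (c : ZMod 2) (x : FramedGraphClass) : Prop :=
  ∃ (n : ℕ) (Γ : FramedGraph (Fin n)), mk Γ = x ∧ ∀ v, Γ.framing v = c

theorem isConst_mk {c : ZMod 2} {V : Type} [Finite V] (Γ : FramedGraph V) :
    IsConst c (mk Γ) ↔ ∀ v, Γ.framing v = c := by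
  constructor
  · rintro ⟨n, Δ, h, hc⟩ v
    obtain ⟨e, he⟩ := ((mk_eq_mk _ _).1 h).symm
    rw [← he, hc]
  · intro h
    exact ⟨_, _, (mk_eq_mk _ _).2 (isIsom_comap_equiv Γ (Finite.equivFin V).symm), fun v => h _⟩

theorem isConst_one {c : ZMod 2} : IsConst c 1 :=
  (isConst_mk _).2 fun v => v.elim

/-- The equivalence, not only closure under products, is what makes killing the other graphs
multiplicative. -/
theorem isConst_mul {c : ZMod 2} (x y : FramedGraphClass) :
    IsConst c (x * y) ↔ IsConst c x ∧ IsConst c y := by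
  induction x using ind with | _ n Γ
  induction y using ind with | _ m Δ
  rw [mk_mul_mk, isConst_mk, isConst_mk, isConst_mk, Sum.forall]
  rfl

end FramedGraphClass

/-! ### Classes of graphs as a spanning set -/

namespace LandoBialgebra

open FramedGraph FramedGraphClass

variable (K : Type*) [Field K]

theorem cls_congr {V W : Type} [Finite V] [Finite W] {Γ : FramedGraph V} {Δ : FramedGraph W}
    (h : IsIsom Γ Δ) : cls K Γ = cls K Δ := by
  unfold cls GraphBialgebra.gen
  rw [(mk_eq_mk _ _).2 h]

theorem cls_disjUnion {V W : Type} [Finite V] [Finite W] (Γ : FramedGraph V)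
    (Δ : FramedGraph W) : cls K (Γ.disjUnion Δ) = cls K Γ * cls K Δ := by
  unfold cls GraphBialgebra.gen
  rw [← map_mul, ← map_mul, mk_mul_mk]

theorem cls_of_isEmpty {V : Type} [Finite V] [IsEmpty V] (Γ : FramedGraph V) :
    cls K Γ = 1 := by
  unfold cls
  rw [GraphBialgebra.gen_of_isEmpty, map_one]

open Classical in
theorem counit_cls {V : Type} [Finite V] (Γ : FramedGraph V) :
    Coalgebra.counit (R := K) (cls K Γ) = if IsEmpty V then (1 : K) else 0 :=
  GraphBialgebra.counit_gen K Γ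

theorem cls_fourTerm {V : Type} [Finite V] (Γ : FramedGraph V) (u v : V)
    (h : Γ.graph.Adj u v) :
    cls K Γ = cls K (Γ.eraseEdge u v) + ((-1 : K) ^ (Γ.framing v).val) •
      (cls K (Γ.slide u v) - cls K ((Γ.slide u v).eraseEdge u v)) := by
  have h0 : Ideal.Quotient.mkₐ K (GraphBialgebra.fourIdeal K) (GraphBialgebra.fourElement K Γ u v)
      = 0 := Ideal.Quotient.eq_zero_iff_mem.2 (GraphBialgebra.fourElement_mem K Γ u v h)
  simp only [GraphBialgebra.fourElement, map_sub, map_smul] at h0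
  rw [sub_sub, sub_eq_zero] at h0
  exact h0

/-- The classes of graphs span the Lando bialgebra. -/
theorem span_cls :
    Submodule.span K {x | ∃ (n : ℕ) (Γ : FramedGraph (Fin n)), x = cls K Γ} = ⊤ := by
  refine eq_top_iff.2 fun x _ => ?_
  obtain ⟨y, rfl⟩ := Ideal.Quotient.mkₐ_surjective K (GraphBialgebra.fourIdeal K) x
  have hy : ∀ y : MonoidAlgebra K FramedGraphClass,
      (Ideal.Quotient.mkₐ K (GraphBialgebra.fourIdeal K)) y ∈
      Submodule.span K {x | ∃ (n : ℕ) (Γ : FramedGraph (Fin n)), x = cls K Γ} := by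
    intro y
    induction y using MonoidAlgebra.induction_on with
    | of a =>
      induction a using ind with | _ n Γ
      exact Submodule.subset_span ⟨n, Γ, rfl⟩
    | add f g hf hg =>
      exact (map_add (Ideal.Quotient.mkₐ K (GraphBialgebra.fourIdeal K)) f g).symm ▸
        Submodule.add_mem _ hf hg
    | smul r f hf =>
      exact (map_smul (Ideal.Quotient.mkₐ K (GraphBialgebra.fourIdeal K)) r f).symm ▸
        Submodule.smul_mem _ r hf
  exact hy y

theorem linearMap_ext {M : Type*} [AddCommGroup M] [Module K M] {φ ψ : LandoBialgebra K →ₗ[K] M}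
    (h : ∀ (n : ℕ) (Γ : FramedGraph (Fin n)), φ (cls K Γ) = ψ (cls K Γ)) : φ = ψ := by
  refine LinearMap.ext_on (span_cls K) ?_
  rintro _ ⟨n, Γ, rfl⟩
  exact h n Γ

/-- The subalgebra generated by the graphs of constant framing is spanned by them. -/
theorem toSubmodule_constSubbialgebra (c : ZMod 2) :
    Subalgebra.toSubmodule (constSubbialgebra K c) = Submodule.span K (constFramed K c) := by
  -- The generators contain the empty graph and are closed under disjoint union, so they already
  -- form a submonoid and no further products are needed.
  have h : (Submonoid.closure (constFramed K c) : Set (LandoBialgebra K)) = constFramed K c := by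
    refine subset_antisymm (fun x hx => ?_) Submonoid.subset_closure
    induction hx using Submonoid.closure_induction with
    | mem x hx => exact hx
    | one => exact ⟨Empty, inferInstance, FramedGraph.empty, fun v => v.elim,
        (cls_of_isEmpty K _).symm⟩
    | mul x y _ _ hx hy =>
      obtain ⟨V, _, Γ, hΓ, rfl⟩ := hx
      obtain ⟨W, _, Δ, hΔ, rfl⟩ := hy
      exact ⟨V ⊕ W, inferInstance, Γ.disjUnion Δ, Sum.forall.2 ⟨hΓ, hΔ⟩,
        (cls_disjUnion K Γ Δ).symm⟩
  unfold constSubbialgebra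
  rw [Algebra.adjoin_eq_span, h]

/-! ### The bialgebra projection onto the graphs of framing 0 -/

open Classical in
/-- The algebra homomorphism from graphs to the Lando bialgebra that kills the graphs with a vertex
of framing `1`. -/
noncomputable def graphProj : GraphBialgebra K →ₐ[K] LandoBialgebra K :=
  GraphBialgebra.lift K
    { toFun := fun x => if IsConst 0 x then
        Ideal.Quotient.mk (GraphBialgebra.fourIdeal K) (GraphBialgebra.of K x) else 0
      map_one' := by rw [if_pos isConst_one, map_one, map_one]
      map_mul' := by
        intro x y
        by_cases hx : IsConst 0 x <;> by_cases hy : IsConst 0 y <;> simp [isConst_mul, hx, hy] }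

open Classical in
theorem graphProj_gen {V : Type} [Finite V] (Γ : FramedGraph V) :
    graphProj K (GraphBialgebra.gen K Γ) = if ∀ v, Γ.framing v = 0 then cls K Γ else 0 := by
  refine (GraphBialgebra.lift_of K _ _).trans ?_
  simp only [MonoidHom.coe_mk, OneHom.coe_mk, isConst_mk]
  rfl

/-- The slide keeps the framing of `v`, and keeps that of `u` when `v` has framing `0`. Hence the
four graphs survive together, leaving a 4-element, or die together. -/
theorem graphProj_fourElement {V : Type} [Finite V] (Γ : FramedGraph V) (u v : V)
    (h : Γ.graph.Adj u v) : graphProj K (GraphBialgebra.fourElement K Γ u v) = 0 := by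
  classical
  have hne : v ≠ u := h.ne'
  have hslide : (∀ w, (Γ.slide u v).framing w = 0) ↔ ∀ w, Γ.framing w = 0 := by
    have hf : ∀ w, (Γ.slide u v).framing w =
      if w = u then Γ.framing u + Γ.framing v else Γ.framing w := fun _ => rfl
    constructor
    · intro hw w
      have hv : Γ.framing v = 0 := by simpa [hf, hne] using hw v
      by_cases hwu : w = u
      · subst hwu
        simpa [hf, hv] using hw w
      · simpa [hf, hwu] using hw w
    · intro hw w
      simp [hf, hw]
  unfold GraphBialgebra.fourElement
  simp only [map_sub, map_smul, graphProj_gen]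
  have e1 : (Γ.eraseEdge u v).framing = Γ.framing := rfl
  have e2 : ((Γ.slide u v).eraseEdge u v).framing = (Γ.slide u v).framing := rfl
  simp only [e1, e2, hslide]
  split_ifs with hΓ
  · have := cls_fourTerm K Γ u v h
    rw [this]
    abel
  · simp

/-- The projection of the Lando bialgebra onto its subbialgebra of graphs of framing `0`, killing
the graphs with a vertex of framing `1`. -/
noncomputable def proj : LandoBialgebra K →ₐ[K] LandoBialgebra K :=
  Ideal.Quotient.liftₐ (GraphBialgebra.fourIdeal K) (graphProj K) (by
    have : GraphBialgebra.fourIdeal K ≤ RingHom.ker (graphProj K) := by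
      refine Ideal.span_le.2 ?_
      rintro _ ⟨V, _, Γ, u, v, huv, rfl⟩
      exact graphProj_fourElement K Γ u v huv
    exact this)

open Classical in
theorem proj_cls {V : Type} [Finite V] (Γ : FramedGraph V) :
    proj K (cls K Γ) = if ∀ v, Γ.framing v = 0 then cls K Γ else 0 :=
  graphProj_gen K Γ

theorem proj_cls_of_forall {V : Type} [Finite V] {Γ : FramedGraph V}
    (h : ∀ v, Γ.framing v = 0) : proj K (cls K Γ) = cls K Γ := by
  classical
  rw [proj_cls, if_pos h]

theorem proj_mem (x : LandoBialgebra K) : proj K x ∈ Submodule.span K (constFramed K 0) := by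
  have hx : x ∈ Submodule.span K {x | ∃ (n : ℕ) (Γ : FramedGraph (Fin n)), x = cls K Γ} := by
    rw [span_cls]; trivial
  induction hx using Submodule.span_induction with
  | mem x h =>
    obtain ⟨n, Γ, rfl⟩ := h
    classical
    rw [proj_cls]
    split_ifs with h
    · exact Submodule.subset_span ⟨_, inferInstance, Γ, h, rfl⟩
    · exact zero_mem _
  | zero => rw [map_zero]; exact zero_mem _
  | add x y _ _ hx hy => rw [map_add]; exact add_mem hx hy
  | smul a x _ hx => rw [map_smul]; exact Submodule.smul_mem _ _ hx

theorem proj_eq_self {x : LandoBialgebra K} (hx : x ∈ Submodule.span K (constFramed K 0)) :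
    proj K x = x := by
  induction hx using Submodule.span_induction with
  | mem x h =>
    obtain ⟨V, _, Γ, hΓ, rfl⟩ := h
    exact proj_cls_of_forall K hΓ
  | zero => rw [map_zero]
  | add x y _ _ hx hy => rw [map_add, hx, hy]
  | smul a x _ hx => rw [map_smul, hx]

/-- Only the empty graph has framing both identically `0` and identically `1`. -/
theorem proj_cls_of_one {V : Type} [Finite V] {Γ : FramedGraph V} (h : ∀ v, Γ.framing v = 1) :
    proj K (cls K Γ) = algebraMap K _ (Coalgebra.counit (R := K) (cls K Γ)) := by
  classical
  rw [proj_cls, counit_cls]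
  rcases isEmpty_or_nonempty V with hV | hV
  · rw [if_pos fun v => (hV.false v).elim, if_pos hV, map_one, cls_of_isEmpty]
  · obtain ⟨v⟩ := hV
    rw [if_neg, if_neg, map_zero]
    · exact fun hV => hV.false v
    · intro h0
      exact one_ne_zero ((h v).symm.trans (h0 v))

theorem proj_eq_counit {x : LandoBialgebra K} (hx : x ∈ Submodule.span K (constFramed K 1)) :
    proj K x = algebraMap K _ (Coalgebra.counit (R := K) x) := by
  induction hx using Submodule.span_induction with
  | mem x h =>
    obtain ⟨V, _, Γ, hΓ, rfl⟩ := h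
    exact proj_cls_of_one K hΓ
  | zero => simp only [map_zero]
  | add x y _ _ hx hy => simp only [map_add, hx, hy]
  | smul a x _ hx => rw [map_smul, hx, map_smul, smul_eq_mul, map_mul, Algebra.smul_def]

/-- A vertex of nonzero framing falls into one of the two parts of every splitting and kills that
tensor factor; without such a vertex all the parts survive. -/
theorem comul_proj (x : LandoBialgebra K) :
    Coalgebra.comul (R := K) (proj K x) =
      TensorProduct.map (proj K).toLinearMap (proj K).toLinearMap (Coalgebra.comul (R := K) x) := by
  have : Coalgebra.comul (R := K) ∘ₗ (proj K).toLinearMap =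
      TensorProduct.map (proj K).toLinearMap (proj K).toLinearMap ∘ₗ Coalgebra.comul (R := K) := by
    refine linearMap_ext K fun n Γ => ?_
    simp only [LinearMap.comp_apply, AlgHom.toLinearMap_apply, comul_cls, map_sum,
      TensorProduct.map_tmul]
    by_cases h : ∀ v, Γ.framing v = 0
    · rw [proj_cls_of_forall K h, comul_cls]
      refine Finset.sum_congr rfl fun s _ => ?_
      rw [proj_cls_of_forall K (Γ := Γ.induce s) fun v => h v,
        proj_cls_of_forall K (Γ := Γ.induce sᶜ) fun v => h v]
    · classical
      rw [proj_cls, if_neg h, map_zero]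
      refine (Finset.sum_eq_zero fun s _ => ?_).symm
      push Not at h
      obtain ⟨v, hv⟩ := h
      by_cases hs : v ∈ s
      · rw [proj_cls, if_neg fun h => hv (h ⟨v, hs⟩), TensorProduct.zero_tmul]
      · rw [proj_cls K (Γ.induce sᶜ), if_neg fun h => hv (h ⟨v, hs⟩), TensorProduct.tmul_zero]
  exact LinearMap.congr_fun this x

/-! ### Primitive elements -/

theorem mem_primitiveSubspace {x : LandoBialgebra K} :
    x ∈ primitiveSubspace K (LandoBialgebra K) ↔
      Coalgebra.comul (R := K) x = x ⊗ₜ[K] 1 + 1 ⊗ₜ[K] x :=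
  Iff.rfl

theorem proj_mem_primitiveSubspace {x : LandoBialgebra K}
    (hx : x ∈ primitiveSubspace K (LandoBialgebra K)) :
    proj K x ∈ primitiveSubspace K (LandoBialgebra K) := by
  rw [mem_primitiveSubspace] at hx ⊢
  rw [comul_proj, hx]
  simp

theorem counit_eq_zero_of_primitive {x : LandoBialgebra K}
    (hx : x ∈ primitiveSubspace K (LandoBialgebra K)) : Coalgebra.counit (R := K) x = 0 := by
  have h := Coalgebra.rTensor_counit_comul (R := K) x
  rw [(mem_primitiveSubspace K).1 hx] at h
  have h' := congrArg (TensorProduct.lid K (LandoBialgebra K)) h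
  -- Counitality reads $\varepsilon(x)1+x=x$; a second application of the counit to
  -- $\varepsilon(x)1=0$ gives the scalar.
  simp only [map_add, LinearMap.rTensor_tmul, TensorProduct.lid_tmul, one_smul,
    Bialgebra.counit_one] at h'
  have h2 := congrArg (Coalgebra.counit (R := K)) (add_eq_right.1 h')
  simpa using h2

/-! ### Factorization into graphs of framing 0 and 1 -/

/-- The span of the products of a graph of framing `0` and a graph of framing `1`. -/
noncomputable def spanProducts : Submodule K (LandoBialgebra K) :=
  Submodule.span K {x | ∃ b ∈ constFramed K 0, ∃ w ∈ constFramed K 1, x = b * w}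

/-- With no edge between the two framings, the graph is the disjoint union of its full subgraphs of
framing `0` and `1`. -/
theorem cls_mem_spanProducts_of_forall_not_adj {V : Type} [Finite V] (Γ : FramedGraph V)
    (h : ∀ u v, Γ.framing u = 0 → Γ.framing v = 1 → ¬ Γ.graph.Adj u v) :
    cls K Γ ∈ spanProducts K := by
  set s : Set V := {v | Γ.framing v = 0} with hs
  have hone : ∀ v ∈ sᶜ, Γ.framing v = 1 := fun v hv => by
    have : ∀ a : ZMod 2, a ≠ 0 → a = 1 := by decide
    exact this _ hv
  refine Submodule.subset_span ⟨_, ⟨s, inferInstance, Γ.induce s, fun v => v.2, rfl⟩,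
    _, ⟨(sᶜ : Set V), inferInstance, Γ.induce sᶜ, fun v => hone v v.2, rfl⟩, ?_⟩
  classical
  rw [← cls_disjUnion]
  refine cls_congr K (IsIsom.symm ⟨⟨Equiv.Set.sumCompl s, ?_⟩, ?_⟩)
  · rintro (a | a) (b | b)
    · simp [FramedGraph.disjUnion, induce, comap]
    · simpa [FramedGraph.disjUnion] using h a b a.2 (hone b b.2)
    · simpa [FramedGraph.disjUnion] using fun hab => h b a b.2 (hone a a.2) hab.symm
    · simp [FramedGraph.disjUnion, induce, comap]
  · rintro (a | a)
    · rfl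
    · rfl

/-- Lexicographic induction on the number of vertices of framing `0`, then of edges. For an edge
from `u` of framing `0` to `v` of framing `1`, erasing it keeps the first number and lowers the
second, while both slid graphs have a smaller first number. -/
theorem cls_mem_spanProducts {V : Type} [Finite V] (Γ : FramedGraph V) :
    cls K Γ ∈ spanProducts K := by
  induction hn : {v | Γ.framing v = 0}.ncard using Nat.strong_induction_on generalizing Γ with
  | _ n ih =>
  induction hm : Γ.graph.edgeSet.ncard using Nat.strong_induction_on generalizing Γ with
  | _ m ih' =>
  by_cases h : ∀ u v, Γ.framing u = 0 → Γ.framing v = 1 → ¬ Γ.graph.Adj u v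
  · exact cls_mem_spanProducts_of_forall_not_adj K Γ h
  push Not at h
  obtain ⟨u, v, hu, hv, huv⟩ := h
  -- Only the framing of `u` changes, from `0` to `0 + 1`.
  have hlt : {w | (Γ.slide u v).framing w = 0}.ncard < n := by
    rw [← hn]
    refine Set.ncard_lt_ncard (Set.ssubset_iff_of_subset ?_ |>.2 ⟨u, hu, ?_⟩) (Set.toFinite _)
    · intro w hw
      by_cases hwu : w = u
      · rw [hwu]; exact hu
      · simpa [slide, hwu] using hw
    · simp [slide, hu, hv]
  rw [cls_fourTerm K Γ u v huv]
  refine add_mem (ih' _ ?_ _ hn rfl)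
    (Submodule.smul_mem _ _ (sub_mem (ih _ hlt _ rfl) (ih _ hlt _ rfl)))
  rw [← hm]
  refine Set.ncard_lt_ncard ?_ (Set.toFinite _)
  refine Set.ssubset_iff_of_subset ?_ |>.2 ⟨s(u, v), huv, ?_⟩
  · exact SimpleGraph.edgeSet_mono (SimpleGraph.deleteEdges_le _)
  · simp [eraseEdge]

theorem spanProducts_eq_top : spanProducts K = ⊤ := by
  rw [eq_top_iff, ← span_cls]
  refine Submodule.span_le.2 ?_
  rintro _ ⟨n, Γ, rfl⟩
  exact cls_mem_spanProducts K Γ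

/-! ### A truncated antipode -/

section Convolution

open WithConv

/-- The difference of the convolution unit and the identity. -/
noncomputable def convDiff : WithConv (LandoBialgebra K →ₗ[K] LandoBialgebra K) :=
  1 - toConv LinearMap.id

theorem convDiff_one : convDiff K 1 = 0 := by
  change algebraMap K (LandoBialgebra K) (Coalgebra.counit (R := K) 1) - 1 = 0
  rw [Bialgebra.counit_one, map_one, sub_self]

/-- `convDiff` kills the empty graph, so each of the `k` convolution factors must receive a nonempty
part of the vertices. -/
theorem convDiff_pow_cls (k : ℕ) {V : Type} [Finite V] (Γ : FramedGraph V)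
    (h : Nat.card V < k) : (convDiff K ^ k) (cls K Γ) = 0 := by
  induction k generalizing V with
  | zero => omega
  | succ k ih =>
    have := Fintype.ofFinite V
    rw [pow_succ', LinearMap.convMul_apply, comul_cls, map_sum, map_sum]
    refine Finset.sum_eq_zero fun s _ => ?_
    rw [TensorProduct.map_tmul, LinearMap.mul'_apply]
    rcases s.eq_empty_or_nonempty with rfl | hs
    · have := convDiff_one K
      rw [cls_of_isEmpty]
      erw [this]
      rw [zero_mul]
    · have hlt : Nat.card (sᶜ : Set V) < k := by
        have h1 := Set.ncard_add_ncard_compl s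
        have h2 := (Set.ncard_pos (Set.toFinite s)).2 hs
        rw [Nat.card_coe_set_eq]
        omega
      have := ih (Γ.induce sᶜ) hlt
      erw [this]
      rw [mul_zero]

/-- The truncated geometric series for the convolution inverse of the identity. -/
noncomputable def truncAntipode (N : ℕ) : LandoBialgebra K →ₗ[K] LandoBialgebra K :=
  (∑ i ∈ Finset.range N, convDiff K ^ i).ofConv

/-- With $d$ for `convDiff`, $\mathrm{id}=1-d$ and $(1-d)\sum_{i<N}d^i=1-d^N$ under convolution,
where $d^N$ vanishes on graphs with fewer than $N$ vertices. -/
theorem mul'_map_truncAntipode_comul (N : ℕ) {V : Type} [Finite V] (Γ : FramedGraph V)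
    (h : Nat.card V < N) :
    LinearMap.mul' K _ (TensorProduct.map LinearMap.id (truncAntipode K N)
      (Coalgebra.comul (R := K) (cls K Γ))) =
      algebraMap K _ (Coalgebra.counit (R := K) (cls K Γ)) := by
  have h1 := mul_neg_geom_sum (convDiff K) N
  have h2 : 1 - convDiff K = toConv LinearMap.id := sub_sub_cancel _ _
  rw [h2] at h1
  have h3 := congrArg (fun f => f.ofConv (cls K Γ)) h1
  have h4 := convDiff_pow_cls K N Γ h
  refine h3.trans ?_
  change algebraMap K _ (Coalgebra.counit (R := K) (cls K Γ)) - (convDiff K ^ N) (cls K Γ) = _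
  rw [h4, sub_zero]

theorem truncAntipode_one {N : ℕ} (hN : 0 < N) : truncAntipode K N 1 = 1 := by
  have h := mul'_map_truncAntipode_comul K N FramedGraph.empty (by simpa using hN)
  rw [cls_of_isEmpty] at h
  simpa [Bialgebra.comul_one, Algebra.TensorProduct.one_def] using h

end Convolution

/-! ### Coinvariants of the projection -/

/-- The coaction of the image of `proj`. -/
noncomputable def coaction : LandoBialgebra K →ₐ[K] LandoBialgebra K ⊗[K] LandoBialgebra K :=
  (Algebra.TensorProduct.map (AlgHom.id K _) (proj K)).comp
    (Bialgebra.comulAlgHom K (LandoBialgebra K))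

theorem coaction_of_zero {b : LandoBialgebra K} (hb : b ∈ constFramed K 0) :
    coaction K b = Coalgebra.comul (R := K) b := by
  obtain ⟨V, _, Γ, hΓ, rfl⟩ := hb
  have := Fintype.ofFinite V
  simp only [coaction, AlgHom.comp_apply, Bialgebra.comulAlgHom_apply, comul_cls, map_sum,
    Algebra.TensorProduct.map_tmul, AlgHom.id_apply]
  refine Finset.sum_congr rfl fun s _ => ?_
  rw [proj_cls_of_forall K (Γ := Γ.induce sᶜ) fun v => hΓ v]

/-- On the right-hand parts, which have framing `1`, `proj` is the counit, so this is counitality.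
-/
theorem coaction_of_one {w : LandoBialgebra K} (hw : w ∈ constFramed K 1) :
    coaction K w = w ⊗ₜ[K] 1 := by
  obtain ⟨V, _, Γ, hΓ, rfl⟩ := hw
  have := Fintype.ofFinite V
  have key : ∀ s : Set V, proj K (cls K (Γ.induce sᶜ)) =
      algebraMap K _ (Coalgebra.counit (R := K) (cls K (Γ.induce sᶜ))) :=
    fun s => proj_cls_of_one K fun v => hΓ v
  have h := Coalgebra.lTensor_counit_comul (R := K) (cls K Γ)
  have h' := congrArg (LinearMap.lTensor (LandoBialgebra K)
    (Algebra.linearMap K (LandoBialgebra K))) h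
  rw [comul_cls] at h'
  simp only [map_sum, LinearMap.lTensor_tmul, Algebra.linearMap_apply, map_one] at h'
  rw [← h']
  simp only [coaction, AlgHom.comp_apply, Bialgebra.comulAlgHom_apply, comul_cls, map_sum,
    Algebra.TensorProduct.map_tmul, AlgHom.id_apply, key]

/-- The truncated projection onto the coinvariants of `coaction`. -/
noncomputable def truncCoinv (N : ℕ) : LandoBialgebra K →ₗ[K] LandoBialgebra K :=
  LinearMap.mul' K _ ∘ₗ TensorProduct.map LinearMap.id (truncAntipode K N) ∘ₗ
    (coaction K).toLinearMap

theorem mul'_map_mul_tmul_one (T : LandoBialgebra K →ₗ[K] LandoBialgebra K)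
    (t : LandoBialgebra K ⊗[K] LandoBialgebra K) (w : LandoBialgebra K) :
    LinearMap.mul' K _ (TensorProduct.map LinearMap.id T (t * w ⊗ₜ[K] 1)) =
      LinearMap.mul' K _ (TensorProduct.map LinearMap.id T t) * w := by
  induction t using TensorProduct.induction_on with
  | zero => simp
  | tmul a b => simp [mul_right_comm]
  | add x y hx hy => rw [add_mul, map_add, map_add, hx, hy, map_add, map_add, add_mul]

/-- On a product $bw$ of a graph of framing `0` and one of framing `1` the coaction is
$\Delta(b)(w\otimes 1)$, so the value is $\varepsilon(b)w$ once $N$ exceeds the number of vertices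
of $b$. A bound uniform in `x` is not needed, but it must hold for all large `N` so that it passes
to sums. -/
theorem exists_truncCoinv_mem (x : LandoBialgebra K) :
    ∃ N₀, ∀ N, N₀ ≤ N → truncCoinv K N x ∈ Submodule.span K (constFramed K 1) := by
  have hx : x ∈ spanProducts K := by rw [spanProducts_eq_top]; trivial
  induction hx using Submodule.span_induction with
  | mem x h =>
    obtain ⟨b, hb, w, hw, rfl⟩ := h
    have hb' := coaction_of_zero K hb
    obtain ⟨V, _, Γ, hΓ, rfl⟩ := hb
    refine ⟨Nat.card V + 1, fun N hN => ?_⟩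
    simp only [truncCoinv, LinearMap.comp_apply, AlgHom.toLinearMap_apply, map_mul, hb',
      coaction_of_one K hw]
    rw [mul'_map_mul_tmul_one, mul'_map_truncAntipode_comul K N Γ (by omega), ← Algebra.smul_def]
    exact Submodule.smul_mem _ _ (Submodule.subset_span hw)
  | zero => exact ⟨0, fun N _ => by rw [map_zero]; exact zero_mem _⟩
  | add x y _ _ hx hy =>
    obtain ⟨a, ha⟩ := hx
    obtain ⟨b, hb⟩ := hy
    refine ⟨max a b, fun N hN => ?_⟩
    rw [map_add]
    exact add_mem (ha N (le_trans (le_max_left _ _) hN)) (hb N (le_trans (le_max_right _ _) hN))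
  | smul c x _ hx =>
    obtain ⟨a, ha⟩ := hx
    refine ⟨a, fun N hN => ?_⟩
    rw [map_smul]
    exact Submodule.smul_mem _ _ (ha N hN)

/-- Such an element is coinvariant, hence fixed by `truncCoinv`, whose values are eventually in the
span of the graphs of framing `1`. -/
theorem mem_span_of_primitive_of_proj_eq_zero {x : LandoBialgebra K}
    (hx : x ∈ primitiveSubspace K (LandoBialgebra K)) (h0 : proj K x = 0) :
    x ∈ Submodule.span K (constFramed K 1) := by
  obtain ⟨N, hN⟩ := exists_truncCoinv_mem K x
  -- The bound `N` may be `0`, and the empty series would not send `1` to `1`.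
  have h := hN (N + 1) (Nat.le_succ N)
  have hc : coaction K x = x ⊗ₜ[K] 1 := by
    simp only [coaction, AlgHom.comp_apply, Bialgebra.comulAlgHom_apply,
      (mem_primitiveSubspace K).1 hx, map_add, Algebra.TensorProduct.map_tmul, AlgHom.id_apply,
      h0, TensorProduct.tmul_zero, add_zero, map_one]
  have ht : truncCoinv K (N + 1) x = x := by
    simp [truncCoinv, hc, truncAntipode_one K N.succ_pos]
  rwa [ht] at h

end LandoBialgebra

/-! ### The direct sum decomposition -/

/-- The primitive subspace of the Lando bialgebra is the direct sum of the primitive subspaces of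
the subbialgebras generated by the graphs of framing identically `0`, respectively `1`; these
summands consist of linear combinations of graphs of framing identically `0`, respectively `1`. -/
theorem mainTheorem9 (K : Type*) [Field K] [CharZero K] :
    LandoBialgebra.constPrimitive K 0 ⊔ LandoBialgebra.constPrimitive K 1 =
        primitiveSubspace K (LandoBialgebra K) ∧
      Disjoint (LandoBialgebra.constPrimitive K 0) (LandoBialgebra.constPrimitive K 1) ∧
      ∀ c : ZMod 2, LandoBialgebra.constPrimitive K c =
        primitiveSubspace K (LandoBialgebra K) ⊓
          Submodule.span K (LandoBialgebra.constFramed K c) := by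
  have hspan : ∀ c : ZMod 2, LandoBialgebra.constPrimitive K c =
      primitiveSubspace K (LandoBialgebra K) ⊓
        Submodule.span K (LandoBialgebra.constFramed K c) := fun c => by
    rw [LandoBialgebra.constPrimitive, LandoBialgebra.toSubmodule_constSubbialgebra]
  refine ⟨le_antisymm ?_ ?_, ?_, hspan⟩
  · exact sup_le inf_le_left inf_le_left
  · intro p hp
    rw [hspan, hspan]
    have hq := LandoBialgebra.proj_mem_primitiveSubspace K hp
    have hqm := LandoBialgebra.proj_mem K p
    have hr := sub_mem hp hq
    refine Submodule.mem_sup.2 ⟨_, ⟨hq, hqm⟩, p - LandoBialgebra.proj K p, ⟨hr, ?_⟩,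
      add_sub_cancel _ _⟩
    -- The remainder is killed because `proj` is idempotent.
    refine LandoBialgebra.mem_span_of_primitive_of_proj_eq_zero K hr ?_
    rw [map_sub, LandoBialgebra.proj_eq_self K hqm, sub_self]
  · rw [hspan, hspan, Submodule.disjoint_def]
    rintro x ⟨hp, h0⟩ ⟨-, h1⟩
    -- For `x` in both summands, $x=\mathrm{proj}\,x=\varepsilon(x)1=0$.
    rw [← LandoBialgebra.proj_eq_self K h0, LandoBialgebra.proj_eq_counit K h1,
      LandoBialgebra.counit_eq_zero_of_primitive K hp, map_zero]
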